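/- Let $d\ge 1$. For $u\in L^1(\mathbb R^d)$ let $\|Du\|(\mathbb R^d)=\sup\{\int u\,\operatorname{div}v : v\in C^1_c(\mathbb R^d;\mathbb R^d),\ |v|\le 1\}$. Let $BV([0,1]^d)$ be the space of (classes of) functions $u\in L^1(\mathbb R^d)$ with $u=0$ a.e. outside $[0,1]^d$ and $\|Du\|(\mathbb R^d)<\infty$, normed by $\|u\|_{BV}=\|u\|_1+\|Du\|(\mathbb R^d)$. For $f\in L^d([0,1]^d)$ let $T_f\in BV([0,1]^d)^*$ be $T_f(u)=\int_{[0,1]^d}fu$, and let $SCH([0,1]^d)$ be the closure of $\{T_f : f\in L^d([0,1]^d)\}$ in $BV([0,1]^d)^*$, with the dual norm. For each $n\ge 0$ let $K_{n,k}$, $0\le k\le 2^{nd}-1$, be the dyadic cubes $\prod_{i=1}^d[2^{-n}k_i,2^{-n}(k_i+1)]\subset[0,1]^d$ ($k_i$ integers), each listed once, numbered so that $K_{n+1,2^dk},\dots,K_{n+1,2^dk+2^d-1}$ are the $2^d$ subcubes of $K_{n,k}$ of side $2^{-(n+1)}$, for all $n$ and $k$. Let $A_1=\begin{pmatrix}1&1\\1&-1\end{pmatrix}$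 and $A_{m+1}=\begin{pmatrix}A_m&A_m\\A_m&-A_m\end{pmatrix}$, with the rows and columns of $A_d$ numbered from $0$ to $2^d-1$, and for $n\ge 0$, $0\le k\le 2^{nd}-1$, $1\le r\le 2^d-1$ let $$g_{n,k,r}=2^{nd/2}\sum_{\ell=0}^{2^d-1}(A_d)_{r,\ell}\,\mathbf 1_{K_{n+1,2^dk+\ell}}.$$ Proposition. There is a constant $C>0$, depending only on $d$, such that for every numbering of the dyadic cubes as above, all $n\ge 0$ and all real scalars $(a_{k,r})_{0\le k\le 2^{nd}-1,\ 1\le r\le 2^d-1}$, $$\frac{1}{2^{n(d/2+1)}C}\max_{1\le r\le 2^d-1}\sum_{k=0}^{2^{nd}-1}|a_{k,r}| \;\le\;\Bigl\|\sum_{k=0}^{2^{nd}-1}\sum_{r=1}^{2^d-1}a_{k,r}T_{g_{n,k,r}}\Bigr\|_{SCH([0,1]^d)} \;\le\; C\,2^{n(d/2-1)}\max_{k,r}|a_{k,r}|.$$ -/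

import Mathlib

noncomputable section

namespace StrongCharge

open MeasureTheory Set
open scoped ENNReal

/-- `ℝᵈ` with its Euclidean norm. -/
abbrev E (d : ℕ) : Type := EuclideanSpace ℝ (Fin d)

/-- The unit cube `[0,1]ᵈ`. -/
def unitCube (d : ℕ) : Set (E d) := {x | ∀ i, x i ∈ Icc (0 : ℝ) 1}

/-! ### Functions of bounded variation -/

/-- The divergence `∑ᵢ ∂ᵢ vᵢ` of a vector field. -/
def divergence {d : ℕ} (v : E d → E d) (x : E d) : ℝ :=
  ∑ i, (fderiv ℝ v x (EuclideanSpace.single i 1)) i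

/-- Admissible test fields: compactly supported `C¹` fields on `ℝᵈ` with `|v| ≤ 1`. -/
def testFields (d : ℕ) : Set (E d → E d) :=
  {v | ContDiff ℝ 1 v ∧ HasCompactSupport v ∧ ∀ x, ‖v x‖ ≤ 1}

/-- The total variation `‖Du‖(ℝᵈ) = sup_v ∫ u div v` of an integrable function. Since `-v` is
admissible whenever `v` is, truncating negative values to `0` does not change the supremum. -/
def variation {d : ℕ} (u : E d → ℝ) : ℝ≥0∞ :=
  ⨆ v ∈ testFields d, ENNReal.ofReal (∫ x, u x * divergence v x)

theorem continuous_divergence {d : ℕ} {v : E d → E d} (hv : v ∈ testFields d) :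
    Continuous (divergence v) := by
  have h := hv.1.continuous_fderiv (by norm_num)
  unfold divergence
  fun_prop

theorem divergence_bdd {d : ℕ} {v : E d → E d} (hv : v ∈ testFields d) :
    ∃ C, ∀ x, ‖divergence v x‖ ≤ C := by
  refine (continuous_divergence hv).bounded_above_of_compact_support ?_
  refine (hv.2.1.fderiv (𝕜 := ℝ)).mono ?_
  intro x hx
  contrapose! hx
  simp only [Function.mem_support, not_not] at hx ⊢
  simp [divergence, hx]

theorem integrable_mul_divergence {d : ℕ} {u : E d → ℝ} (hu : Integrable u)
    {v : E d → E d} (hv : v ∈ testFields d) :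
    Integrable (fun x => u x * divergence v x) := by
  obtain ⟨C, hC⟩ := divergence_bdd hv
  exact hu.mul_bdd (c := C) (continuous_divergence hv).aestronglyMeasurable
    (Filter.Eventually.of_forall hC)

theorem neg_mem_testFields {d : ℕ} {v : E d → E d} (hv : v ∈ testFields d) :
    -v ∈ testFields d :=
  ⟨hv.1.neg, hv.2.1.neg, fun x => by simpa using hv.2.2 x⟩

theorem divergence_neg {d : ℕ} (v : E d → E d) (x : E d) :
    divergence (-v) x = -divergence v x := by
  simp [divergence, fderiv_neg]

theorem variation_congr {d : ℕ} {u w : E d → ℝ} (h : u =ᵐ[volume] w) :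
    variation u = variation w := by
  unfold variation
  refine iSup_congr fun v => iSup_congr fun _ => ?_
  congr 1
  refine integral_congr_ae ?_
  filter_upwards [h] with x hx
  rw [hx]

theorem variation_add_le {d : ℕ} {u w : E d → ℝ} (hu : Integrable u) (hw : Integrable w) :
    variation (u + w) ≤ variation u + variation w := by
  refine iSup₂_le fun v hv => ?_
  have h : ∫ x, (u + w) x * divergence v x
      = (∫ x, u x * divergence v x) + ∫ x, w x * divergence v x := by
    rw [← integral_add (integrable_mul_divergence hu hv) (integrable_mul_divergence hw hv)]
    simp only [Pi.add_apply, add_mul]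
  rw [h]
  refine ENNReal.ofReal_add_le.trans (add_le_add ?_ ?_)
  · exact le_iSup₂ (f := fun v (_ : v ∈ testFields d) =>
      ENNReal.ofReal (∫ x, u x * divergence v x)) v hv
  · exact le_iSup₂ (f := fun v (_ : v ∈ testFields d) =>
      ENNReal.ofReal (∫ x, w x * divergence v x)) v hv

theorem variation_smul_le {d : ℕ} (c : ℝ) (u : E d → ℝ) :
    variation (c • u) ≤ ENNReal.ofReal |c| * variation u := by
  refine iSup₂_le fun v hv => ?_
  have h : ∫ x, (c • u) x * divergence v x = c * ∫ x, u x * divergence v x := by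
    rw [← integral_const_mul]
    simp only [Pi.smul_apply, smul_eq_mul, mul_assoc]
  rw [h]
  rcases le_total 0 c with hc | hc
  · rw [ENNReal.ofReal_mul hc, abs_of_nonneg hc]
    gcongr
    exact le_iSup₂ (f := fun v (_ : v ∈ testFields d) =>
      ENNReal.ofReal (∫ x, u x * divergence v x)) v hv
  · have h2 : c * ∫ x, u x * divergence v x
        = (-c) * ∫ x, u x * divergence (-v) x := by
      simp only [divergence_neg, mul_neg, integral_neg]
      ring
    rw [h2, ENNReal.ofReal_mul (by linarith), abs_of_nonpos hc]
    gcongr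
    exact le_iSup₂ (f := fun v (_ : v ∈ testFields d) =>
      ENNReal.ofReal (∫ x, u x * divergence v x)) (-v) (neg_mem_testFields hv)

theorem variation_zero {d : ℕ} : variation (0 : E d → ℝ) = 0 := by
  simp [variation]

theorem variation_smul {d : ℕ} (c : ℝ) (u : E d → ℝ) :
    variation (c • u) = ENNReal.ofReal |c| * variation u := by
  refine le_antisymm (variation_smul_le c u) ?_
  rcases eq_or_ne c 0 with rfl | hc
  · simp
  · have h := variation_smul_le c⁻¹ (c • u)
    rw [inv_smul_smul₀ hc] at h
    calc ENNReal.ofReal |c| * variation u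
        ≤ ENNReal.ofReal |c| * (ENNReal.ofReal |c⁻¹| * variation (c • u)) := by gcongr
      _ = variation (c • u) := by
        rw [← mul_assoc, ← ENNReal.ofReal_mul (abs_nonneg c), ← abs_mul,
          mul_inv_cancel₀ hc, abs_one, ENNReal.ofReal_one, one_mul]

theorem integrable_L1 {d : ℕ} (u : Lp ℝ 1 (volume : Measure (E d))) : Integrable u :=
  L1.integrable_coeFn u

/-- The classes in `L¹(ℝᵈ)` that vanish a.e. outside `[0,1]ᵈ` and have finite variation
over `ℝᵈ`. -/
def bvSubmodule (d : ℕ) : Submodule ℝ (Lp ℝ 1 (volume : Measure (E d))) where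
  carrier := {u | (∀ᵐ x, x ∉ unitCube d → u x = 0) ∧ variation u < ∞}
  zero_mem' := by
    have h := Lp.coeFn_zero ℝ 1 (volume : Measure (E d))
    refine ⟨?_, ?_⟩
    · filter_upwards [h] with x hx _
      rw [hx, Pi.zero_apply]
    · rw [variation_congr h, variation_zero]
      exact ENNReal.zero_lt_top
  add_mem' := by
    rintro u w ⟨hu, hu'⟩ ⟨hw, hw'⟩
    have h := Lp.coeFn_add u w
    refine ⟨?_, ?_⟩
    · filter_upwards [h, hu, hw] with x hx h1 h2 hx'
      rw [hx, Pi.add_apply, h1 hx', h2 hx', add_zero]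
    · rw [variation_congr h]
      exact (variation_add_le (integrable_L1 u) (integrable_L1 w)).trans_lt
        (ENNReal.add_lt_top.2 ⟨hu', hw'⟩)
  smul_mem' := by
    rintro c u ⟨hu, hu'⟩
    have h := Lp.coeFn_smul c u
    refine ⟨?_, ?_⟩
    · filter_upwards [h, hu] with x hx h1 hx'
      rw [hx, Pi.smul_apply, h1 hx', smul_zero]
    · rw [variation_congr h, variation_smul]
      exact ENNReal.mul_lt_top ENNReal.ofReal_lt_top hu'

/-- The space `BV([0,1]ᵈ)`. A type synonym of `bvSubmodule d`, so that it does not carry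
the `L¹` norm. -/
def BV (d : ℕ) : Type := bvSubmodule d

instance (d : ℕ) : AddCommGroup (BV d) := inferInstanceAs (AddCommGroup (bvSubmodule d))

instance (d : ℕ) : Module ℝ (BV d) := inferInstanceAs (Module ℝ (bvSubmodule d))

/-- The class in `L¹(ℝᵈ)` of a function of bounded variation. -/
def BV.toL1 {d : ℕ} : BV d →ₗ[ℝ] Lp ℝ 1 (volume : Measure (E d)) := (bvSubmodule d).subtype

/-- The norm `‖u‖_BV = ‖u‖₁ + ‖Du‖(ℝᵈ)`. -/
instance (d : ℕ) : Norm (BV d) := ⟨fun u => ‖u.toL1‖ + (variation u.toL1).toReal⟩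

theorem BV.norm_def {d : ℕ} (u : BV d) : ‖u‖ = ‖u.toL1‖ + (variation u.toL1).toReal := rfl

theorem BV.variation_lt_top {d : ℕ} (u : BV d) : variation u.toL1 < ∞ := u.2.2

theorem BV.core (d : ℕ) : NormedSpace.Core ℝ (BV d) where
  norm_nonneg u := by rw [BV.norm_def]; positivity
  norm_smul c u := by
    rw [BV.norm_def, BV.norm_def, map_smul, norm_smul, variation_congr (Lp.coeFn_smul c u.toL1),
      variation_smul, ENNReal.toReal_mul, ENNReal.toReal_ofReal (abs_nonneg c), Real.norm_eq_abs]
    ring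
  norm_triangle u w := by
    rw [BV.norm_def, BV.norm_def, BV.norm_def, map_add, variation_congr (Lp.coeFn_add _ _)]
    have h1 := norm_add_le u.toL1 w.toL1
    have h2 := ENNReal.toReal_mono
      (ENNReal.add_lt_top.2 ⟨u.variation_lt_top, w.variation_lt_top⟩).ne
      (variation_add_le (integrable_L1 u.toL1) (integrable_L1 w.toL1))
    rw [ENNReal.toReal_add u.variation_lt_top.ne w.variation_lt_top.ne] at h2
    linarith
  norm_eq_zero_iff u := by
    constructor
    · intro h
      rw [BV.norm_def] at h
      have h1 : ‖u.toL1‖ = 0 := by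
        have := norm_nonneg u.toL1
        have : 0 ≤ (variation u.toL1).toReal := ENNReal.toReal_nonneg
        linarith
      exact Subtype.ext (norm_eq_zero.1 h1)
    · rintro rfl
      rw [BV.norm_def, map_zero, variation_congr (Lp.coeFn_zero ℝ 1 _), variation_zero]
      simp

instance (d : ℕ) : NormedAddCommGroup (BV d) := NormedAddCommGroup.ofCore (BV.core d)

instance (d : ℕ) : NormedSpace ℝ (BV d) := NormedSpace.ofCore (BV.core d)

/-! ### Strong charge functionals -/

/-- The functional `α` on `BV([0,1]ᵈ)` is `T_f : u ↦ ∫_{[0,1]ᵈ} f u`. -/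
def IsT {d : ℕ} (f : E d → ℝ) (α : StrongDual ℝ (BV d)) : Prop :=
  ∀ u : BV d, IntegrableOn (fun x => f x * u.toL1 x) (unitCube d) ∧
    α u = ∫ x in unitCube d, f x * u.toL1 x

/-- The range of `T : Lᵈ([0,1]ᵈ) → BV([0,1]ᵈ)*`. -/
def rangeT (d : ℕ) : Submodule ℝ (StrongDual ℝ (BV d)) where
  carrier := {α | ∃ f : E d → ℝ, MemLp f d (volume.restrict (unitCube d)) ∧ IsT f α}
  zero_mem' := ⟨0, MemLp.zero, fun u => by simp⟩
  add_mem' := by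
    rintro α β ⟨f, hf, hα⟩ ⟨g, hg, hβ⟩
    refine ⟨f + g, hf.add hg, fun u => ⟨?_, ?_⟩⟩
    · have h := (hα u).1.add (hβ u).1
      refine h.congr (Filter.Eventually.of_forall fun x => ?_)
      simp only [Pi.add_apply, add_mul]
    · rw [add_apply, (hα u).2, (hβ u).2,
        ← integral_add (hα u).1 (hβ u).1]
      simp only [Pi.add_apply, add_mul]
  smul_mem' := by
    rintro c α ⟨f, hf, hα⟩
    refine ⟨c • f, hf.const_smul c, fun u => ⟨?_, ?_⟩⟩
    · have h := (hα u).1.const_mul c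
      refine h.congr (Filter.Eventually.of_forall fun x => ?_)
      simp only [Pi.smul_apply, smul_eq_mul, mul_assoc]
    · rw [smul_apply, (hα u).2, smul_eq_mul, ← integral_const_mul]
      simp only [Pi.smul_apply, smul_eq_mul, mul_assoc]

/-- The space `SCH([0,1]ᵈ)` of strong charge functionals: the closure of the range of `T` in
`BV([0,1]ᵈ)*`, with the norm of `BV([0,1]ᵈ)*`. -/
abbrev SCH (d : ℕ) : Submodule ℝ (StrongDual ℝ (BV d)) := (rangeT d).topologicalClosure

theorem integrableOn_mul {d : ℕ} {f : E d → ℝ}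
    (hf : MemLp f ∞ (volume.restrict (unitCube d))) (u : BV d) :
    IntegrableOn (fun x => f x * u.toL1 x) (unitCube d) :=
  hf.integrable_mul ((memLp_one_iff_integrable).2 (integrable_L1 u.toL1).integrableOn)

/-- `T_f` as a continuous functional, for bounded `f`. -/
def boundedT {d : ℕ} (f : E d → ℝ) (hf : MemLp f ∞ (volume.restrict (unitCube d))) :
    StrongDual ℝ (BV d) :=
  LinearMap.mkContinuous
    { toFun := fun u => ∫ x in unitCube d, f x * u.toL1 x
      map_add' := fun u w => by
        rw [← integral_add (integrableOn_mul hf u) (integrableOn_mul hf w)]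
        refine integral_congr_ae ?_
        filter_upwards [ae_restrict_of_ae (Lp.coeFn_add u.toL1 w.toL1)] with x hx
        rw [map_add, hx, Pi.add_apply, mul_add]
      map_smul' := fun c u => by
        rw [RingHom.id_apply, smul_eq_mul, ← integral_const_mul]
        refine integral_congr_ae ?_
        filter_upwards [ae_restrict_of_ae (Lp.coeFn_smul c u.toL1)] with x hx
        rw [map_smul, hx, Pi.smul_apply, smul_eq_mul]
        ring }
    (eLpNorm f ∞ (volume.restrict (unitCube d))).toReal
    (fun u => by
      set M := (eLpNorm f ∞ (volume.restrict (unitCube d))).toReal with hM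
      have hb : ∀ᵐ x ∂(volume.restrict (unitCube d)), ‖f x‖ ≤ M := by
        have h := ae_le_eLpNormEssSup (f := f) (μ := volume.restrict (unitCube d))
        filter_upwards [h] with x hx
        rw [hM, eLpNorm_exponent_top, ← toReal_enorm]
        exact ENNReal.toReal_mono (by simpa using hf.2.ne) hx
      have hu := (integrable_L1 u.toL1)
      calc ‖∫ x in unitCube d, f x * u.toL1 x‖
          ≤ ∫ x in unitCube d, M * ‖u.toL1 x‖ := by
            refine norm_integral_le_of_norm_le (hu.norm.integrableOn.const_mul M) ?_
            filter_upwards [hb] with x hx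
            rw [norm_mul]
            gcongr
        _ = M * ∫ x in unitCube d, ‖u.toL1 x‖ := integral_const_mul _ _
        _ ≤ M * ‖u.toL1‖ := by
            rw [L1.norm_eq_integral_norm]
            gcongr
            · exact Filter.Eventually.of_forall fun x => norm_nonneg _
            · exact hu.norm
            · exact Measure.restrict_le_self
        _ ≤ M * ‖u‖ := by
            rw [BV.norm_def]
            gcongr
            have : 0 ≤ (variation u.toL1).toReal := ENNReal.toReal_nonneg
            linarith)

theorem volume_unitCube_lt_top (d : ℕ) : volume (unitCube d) < ∞ := by
  refine (Bornology.IsBounded.measure_lt_top ?_)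
  refine isBounded_iff_forall_norm_le.2 ⟨√d, fun x hx => ?_⟩
  rw [EuclideanSpace.norm_eq]
  refine Real.sqrt_le_sqrt ?_
  calc ∑ i, ‖x i‖ ^ 2 ≤ ∑ _i : Fin d, (1 : ℝ) := by
        refine Finset.sum_le_sum fun i _ => ?_
        have h := hx i
        rw [Real.norm_eq_abs, sq_abs]
        nlinarith [h.1, h.2]
    _ = d := by simp

theorem boundedT_mem {d : ℕ} (f : E d → ℝ) (hf : MemLp f ∞ (volume.restrict (unitCube d))) :
    boundedT f hf ∈ SCH d := by
  have : IsFiniteMeasure (volume.restrict (unitCube d)) :=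
    ⟨by simpa using volume_unitCube_lt_top d⟩
  exact Submodule.le_topologicalClosure _
    ⟨f, hf.mono_exponent le_top, fun u => ⟨integrableOn_mul hf u, rfl⟩⟩

/-- The strong charge functional `T_f`, for bounded `f`. -/
def T {d : ℕ} (f : E d → ℝ) (hf : MemLp f ∞ (volume.restrict (unitCube d))) : SCH d :=
  ⟨boundedT f hf, boundedT_mem f hf⟩

/-! ### Dyadic cubes and Haar functions -/

/-- The dyadic cubes `∏ᵢ [2⁻ⁿ kᵢ, 2⁻ⁿ (kᵢ + 1)]`, `0 ≤ kᵢ ≤ 2ⁿ - 1`, of generation `n`. -/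
def dyadicCubes (d n : ℕ) : Set (Set (E d)) :=
  {Q | ∃ m : Fin d → ℕ, (∀ i, m i < 2 ^ n) ∧
    Q = {x | ∀ i, x i ∈ Icc ((m i : ℝ) / 2 ^ n) (((m i : ℝ) + 1) / 2 ^ n)}}

/-- The index `2ᵈ k + ℓ`. -/
def childIndex {d n : ℕ} (k : Fin (2 ^ (n * d))) (l : Fin (2 ^ d)) : Fin (2 ^ ((n + 1) * d)) :=
  ⟨2 ^ d * k + l, by
    have hk := k.2
    have hl := l.2
    calc 2 ^ d * (k : ℕ) + l < 2 ^ d * k + 2 ^ d := by omega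
      _ = 2 ^ d * (k + 1) := by ring
      _ ≤ 2 ^ d * 2 ^ (n * d) := Nat.mul_le_mul_left _ hk
      _ = 2 ^ ((n + 1) * d) := by ring⟩

/-- An admissible numbering `K_{n,k}` of the dyadic cubes: for each `n`, the cubes `K_{n,k}`,
`0 ≤ k < 2^{nd}`, are all the dyadic cubes of generation `n`, without repetition, and the
`K_{n+1,2ᵈk+ℓ}`, `0 ≤ ℓ < 2ᵈ`, are the dyadic subcubes of generation `n + 1` of `K_{n,k}`. -/
structure DyadicNumbering (d : ℕ) where
  cube : ∀ n : ℕ, Fin (2 ^ (n * d)) ≃ dyadicCubes d n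
  children : ∀ (n : ℕ) (k : Fin (2 ^ (n * d))),
    range (fun l : Fin (2 ^ d) => (cube (n + 1) (childIndex k l) : Set (E d))) =
      {Q | Q ∈ dyadicCubes d (n + 1) ∧ Q ⊆ cube n k}

/-- The matrix `A_d` of order `2ᵈ`: `A_{d+1}` is the block matrix with rows `(A_d, A_d)` and
`(A_d, -A_d)`, starting from the one by one matrix `1`. -/
def haarMatrix : (d : ℕ) → Matrix (Fin (2 ^ d)) (Fin (2 ^ d)) ℝ
  | 0 => fun _ _ => 1
  | d + 1 =>
    let e : Fin (2 ^ (d + 1)) ≃ Fin (2 ^ d) ⊕ Fin (2 ^ d) :=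
      (finCongr (by ring)).trans finSumFinEquiv.symm
    (Matrix.fromBlocks (haarMatrix d) (haarMatrix d) (haarMatrix d) (-haarMatrix d)).submatrix e e

/-- The type numbers `r ∈ {1, …, 2ᵈ - 1}`. -/
abbrev TypeNumber (d : ℕ) : Type := {r : Fin (2 ^ d) // r ≠ 0}

/-- The Haar function `g_{n,k,r} = 2^{nd/2} ∑_ℓ (A_d)_{r,ℓ} 1_{K_{n+1,2ᵈk+ℓ}}`. -/
def haar {d : ℕ} (K : DyadicNumbering d) (n : ℕ) (k : Fin (2 ^ (n * d))) (r : TypeNumber d) :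
    E d → ℝ := fun x =>
  (2 : ℝ) ^ ((n : ℝ) * d / 2) * ∑ l : Fin (2 ^ d), haarMatrix d r l *
    indicator (K.cube (n + 1) (childIndex k l) : Set (E d)) (fun _ => (1 : ℝ)) x

theorem measurableSet_dyadicCube {d n : ℕ} (Q : dyadicCubes d n) :
    MeasurableSet (Q : Set (E d)) := by
  obtain ⟨Q, m, hm, rfl⟩ := Q
  simp only [Set.ofPred_forall]
  exact MeasurableSet.iInter fun i =>
    measurableSet_Icc.preimage (by fun_prop)

theorem memLp_haar {d : ℕ} (K : DyadicNumbering d) (n : ℕ) (k : Fin (2 ^ (n * d)))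
    (r : TypeNumber d) : MemLp (haar K n k r) ∞ (volume.restrict (unitCube d)) := by
  have h : ∀ l : Fin (2 ^ d), MemLp (fun x => haarMatrix d r l *
      indicator (K.cube (n + 1) (childIndex k l) : Set (E d)) (fun _ => (1 : ℝ)) x) ∞
      (volume.restrict (unitCube d)) := fun l =>
    ((memLp_top_const (1 : ℝ)).indicator (measurableSet_dyadicCube _)).const_mul _
  exact (memLp_finsetSum Finset.univ fun l _ => h l).const_mul _

/-- The strong charge functional `T_{g_{n,k,r}}`. -/
def haarCharge {d : ℕ} (K : DyadicNumbering d) (n : ℕ) (k : Fin (2 ^ (n * d)))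
    (r : TypeNumber d) : SCH d := T (haar K n k r) (memLp_haar K n k r)

end StrongCharge

end

noncomputable section

namespace StrongCharge

open MeasureTheory Set Filter Topology
open scoped ENNReal NNReal Convolution

/-!
Convolving `u ∈ BV` with a test function gives a function with Lipschitz constant `‖Du‖`, because
its directional derivatives are integrals of `u` against divergences. By duality
`∫ |u (x + h) - u x| dx ≤ |h| ‖Du‖`, and averaging over `h` in a ball of the diameter of a dyadic
cube of generation `n` yields `∑ₖ ∫_{K_{n,k}} |u - u_{K_{n,k}}| ≤ C 2⁻ⁿ ‖Du‖`, where `u_K` is the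
mean of `u` over `K`. Since `g_{n,k,r}` has mean zero, is supported in `K_{n,k}` and has absolute
value `2^{nd/2}`, this is the upper bound.

For the lower bound, the `g_{n,k,r}` are orthonormal because the rows of `A_d` are orthogonal, and
they belong to `BV`. Hence the functional takes the value `∑ₖ |a_{k,r}|` at
`∑ₖ sign(a_{k,r}) g_{n,k,r}`, whose norm is at most a multiple of `2^{n(d/2+1)}` since a cube of
side `s` has perimeter `2 d sᵈ⁻¹`.
-/

/-! ### Translates of functions of bounded variation -/

section TestFunctions

variable {F : Type*} [NormedAddCommGroup F] [NormedSpace ℝ F]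

/-- Scalar test functions: compactly supported `C¹` functions with values in `[-1, 1]`, the scalar
counterpart of `testFields`. -/
def testFunctions (F : Type*) [NormedAddCommGroup F] [NormedSpace ℝ F] : Set (F → ℝ) :=
  {ψ | ContDiff ℝ 1 ψ ∧ HasCompactSupport ψ ∧ ∀ x, |ψ x| ≤ 1}

theorem comp_sub_left_mem_testFunctions {ψ : F → ℝ} (hψ : ψ ∈ testFunctions F) (x : F) :
    (fun y => ψ (x - y)) ∈ testFunctions F :=
  ⟨hψ.1.comp (contDiff_const.sub contDiff_id), hψ.2.1.comp_homeomorph (Homeomorph.subLeft x),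
    fun y => hψ.2.2 (x - y)⟩

theorem div_sqrt_sq_add_sq_mem_testFunctions {g : F → ℝ} (hg : ContDiff ℝ 1 g)
    (hg' : HasCompactSupport g) {δ : ℝ} (hδ : 0 < δ) :
    (fun x => g x / √(g x ^ 2 + δ ^ 2)) ∈ testFunctions F := by
  have hpos : ∀ x, 0 < g x ^ 2 + δ ^ 2 := fun x => by positivity
  refine ⟨hg.div (((hg.pow 2).add contDiff_const).sqrt fun x => (hpos x).ne')
    fun x => (Real.sqrt_pos.2 (hpos x)).ne', ?_, fun x => ?_⟩
  · exact hg'.mono fun x hx hgx => hx (by simp only [hgx, zero_div])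
  · rw [abs_div, abs_of_nonneg (Real.sqrt_nonneg _)]
    exact div_le_one_of_le₀ (Real.abs_le_sqrt (by linarith [sq_nonneg δ])) (Real.sqrt_nonneg _)

theorem abs_le_mul_div_sqrt_sq_add_sq_add (t : ℝ) {δ : ℝ} (hδ : 0 < δ) :
    |t| ≤ t * (t / √(t ^ 2 + δ ^ 2)) + δ := by
  have hs : 0 < √(t ^ 2 + δ ^ 2) := by positivity
  have hts : |t| ≤ √(t ^ 2 + δ ^ 2) := Real.abs_le_sqrt (by linarith [sq_nonneg δ])
  have hst : √(t ^ 2 + δ ^ 2) ≤ |t| + δ := by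
    refine Real.sqrt_le_iff.2 ⟨by positivity, ?_⟩
    nlinarith [sq_abs t, abs_nonneg t]
  rw [mul_div_assoc', div_add' _ _ _ hs.ne', le_div_iff₀ hs]
  nlinarith [sq_abs t, abs_nonneg t]

variable [MeasurableSpace F] [BorelSpace F] {μ : Measure F}

theorem integrable_mul_testFunction {u ψ : F → ℝ} (hu : Integrable u μ)
    (hψ : ψ ∈ testFunctions F) : Integrable (fun x => u x * ψ x) μ :=
  hu.mul_bdd hψ.1.continuous.aestronglyMeasurable (Eventually.of_forall hψ.2.2)

theorem integral_abs_le_of_contDiff_of_forall_testFunctions [IsFiniteMeasureOnCompacts μ]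
    {g : F → ℝ} (hg : ContDiff ℝ 1 g) (hg' : HasCompactSupport g) {c : ℝ}
    (hc : ∀ ψ ∈ testFunctions F, ∫ x, g x * ψ x ∂μ ≤ c) : ∫ x, |g x| ∂μ ≤ c := by
  have hgi : Integrable g μ := hg.continuous.integrable_of_hasCompactSupport hg'
  have hK : μ (tsupport g) ≠ ∞ := hg'.isCompact.measure_ne_top
  have hKm : MeasurableSet (tsupport g) := (isClosed_tsupport g).measurableSet
  have hbound : ∀ δ > 0, ∫ x, |g x| ∂μ ≤ c + μ.real (tsupport g) * δ := by
    intro δ hδ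
    have hψ := div_sqrt_sq_add_sq_mem_testFunctions hg hg' hδ
    have hi : Integrable ((tsupport g).indicator fun _ => δ) μ :=
      (integrable_indicator_iff hKm).2 (integrableOn_const hK)
    calc ∫ x, |g x| ∂μ
        ≤ ∫ x, (g x * (g x / √(g x ^ 2 + δ ^ 2)) + (tsupport g).indicator (fun _ => δ) x) ∂μ := by
          refine integral_mono hgi.abs ((integrable_mul_testFunction hgi hψ).add hi) fun x => ?_
          by_cases hx : x ∈ tsupport g
          · simpa only [indicator_of_mem hx] using abs_le_mul_div_sqrt_sq_add_sq_add (g x) hδ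
          · simp [indicator_of_notMem hx, image_eq_zero_of_notMem_tsupport hx]
      _ ≤ c + μ.real (tsupport g) * δ := by
          rw [integral_add (integrable_mul_testFunction hgi hψ) hi, integral_indicator_const _ hKm,
            smul_eq_mul]
          exact add_le_add_left (hc _ hψ) _
  have hlim : Tendsto (fun δ => c + μ.real (tsupport g) * δ) (𝓝[>] 0) (𝓝 c) := by
    refine tendsto_nhdsWithin_of_tendsto_nhds ?_
    exact Continuous.tendsto' (by fun_prop) _ _ (by simp)
  exact ge_of_tendsto hlim (eventually_nhdsWithin_of_forall hbound)

theorem integral_abs_le_of_forall_testFunctions [FiniteDimensional ℝ F]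
    [IsFiniteMeasureOnCompacts μ] {w : F → ℝ} (hw : Integrable w μ) {c : ℝ}
    (hc : ∀ ψ ∈ testFunctions F, ∫ x, w x * ψ x ∂μ ≤ c) : ∫ x, |w x| ∂μ ≤ c := by
  refine le_of_forall_pos_le_add fun ε hε => ?_
  obtain ⟨g, hg', hg, hwg⟩ := (memLp_one_iff_integrable.2 hw).exist_eLpNorm_sub_le
    ENNReal.one_ne_top le_rfl (half_pos hε)
  have hg1 : ContDiff ℝ 1 g := hg.of_le (by simp)
  have hgi : Integrable g μ := hg1.continuous.integrable_of_hasCompactSupport hg'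
  have hwgi : Integrable (fun x => w x - g x) μ := hw.sub hgi
  have hdist : ∫ x, |w x - g x| ∂μ ≤ ε / 2 := by
    rw [eLpNorm_one_eq_lintegral_enorm,
      ← ofReal_integral_norm_eq_lintegral_enorm (hw.sub hgi)] at hwg
    exact (ENNReal.ofReal_le_ofReal_iff (by positivity)).1 hwg
  have hg_le : ∫ x, |g x| ∂μ ≤ c + ε / 2 := by
    refine integral_abs_le_of_contDiff_of_forall_testFunctions hg1 hg' fun ψ hψ => ?_
    calc ∫ x, g x * ψ x ∂μ
        ≤ ∫ x, (w x * ψ x + |w x - g x|) ∂μ := by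
          refine integral_mono (integrable_mul_testFunction hgi hψ)
            ((integrable_mul_testFunction hw hψ).add hwgi.abs) fun x => ?_
          have h : |(w x - g x) * ψ x| ≤ |w x - g x| :=
            (abs_mul _ _).trans_le (mul_le_of_le_one_right (abs_nonneg _) (hψ.2.2 x))
          linarith [neg_le_of_abs_le h]
      _ ≤ c + ε / 2 := by
          rw [integral_add (integrable_mul_testFunction hw hψ) hwgi.abs]
          exact add_le_add (hc ψ hψ) hdist
  calc ∫ x, |w x| ∂μ ≤ ∫ x, (|g x| + |w x - g x|) ∂μ := by
        refine integral_mono hw.abs (hgi.abs.add hwgi.abs) fun x => ?_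
        simpa using abs_add_le (g x) (w x - g x)
    _ = ∫ x, |g x| ∂μ + ∫ x, |w x - g x| ∂μ := integral_add hgi.abs hwgi.abs
    _ ≤ c + ε := by linarith

end TestFunctions

section Translation

variable {d : ℕ} {u : E d → ℝ}

theorem abs_integral_mul_divergence_le (hu : variation u ≠ ∞) {v : E d → E d}
    (hv : v ∈ testFields d) : |∫ x, u x * divergence v x| ≤ (variation u).toReal := by
  have h_le : ∀ w ∈ testFields d, ∫ x, u x * divergence w x ≤ (variation u).toReal :=
    fun w hw => (ENNReal.ofReal_le_iff_le_toReal hu).1 <|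
      le_iSup₂ (f := fun v (_ : v ∈ testFields d) =>
        ENNReal.ofReal (∫ x, u x * divergence v x)) w hw
  refine abs_le'.2 ⟨h_le v hv, ?_⟩
  simpa only [divergence_neg, mul_neg, integral_neg] using h_le (-v) (neg_mem_testFields hv)

theorem smul_const_mem_testFields {ψ : E d → ℝ} (hψ : ψ ∈ testFunctions (E d)) {e : E d}
    (he : ‖e‖ ≤ 1) : (fun x => ψ x • e) ∈ testFields d :=
  ⟨hψ.1.smul contDiff_const, hψ.2.1.smul_right, fun x => by
    rw [norm_smul]
    exact mul_le_one₀ (hψ.2.2 x) (norm_nonneg e) he⟩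

theorem divergence_smul_const {ψ : E d → ℝ} {x : E d} (hψ : DifferentiableAt ℝ ψ x) (e : E d) :
    divergence (fun y => ψ y • e) x = fderiv ℝ ψ x e := by
  have he : ∑ i, e i • EuclideanSpace.single i (1 : ℝ) = e := by
    ext j
    simp [Pi.single_apply]
  conv_rhs => rw [← he, map_sum]
  refine Finset.sum_congr rfl fun i _ => ?_
  simp [fderiv_smul_const hψ, mul_comm]

theorem lipschitzWith_convolution (hu : Integrable u) (hu' : variation u ≠ ∞) {ψ : E d → ℝ}
    (hψ : ψ ∈ testFunctions (E d)) :
    LipschitzWith (variation u).toNNReal (u ⋆[ContinuousLinearMap.lsmul ℝ ℝ, volume] ψ) := by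
  have hderiv := hψ.2.1.hasFDerivAt_convolution_right (ContinuousLinearMap.lsmul ℝ ℝ)
    hu.locallyIntegrable hψ.1
  refine lipschitzWith_of_nnnorm_fderiv_le (𝕜 := ℝ) (fun x => (hderiv x).differentiableAt)
    fun x => ?_
  rw [(hderiv x).fderiv, ← NNReal.coe_le_coe, coe_nnnorm]
  refine ContinuousLinearMap.opNorm_le_of_unit_norm ENNReal.toReal_nonneg fun e he => ?_
  have hdiv : ∀ t, divergence (fun y => ψ (x - y) • e) t = -fderiv ℝ ψ (x - t) e := fun t => by
    have h : HasFDerivAt (fun y => ψ (x - y)) _ t :=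
      ((hψ.1.differentiable one_ne_zero) (x - t)).hasFDerivAt.comp t
        ((hasFDerivAt_id t).const_sub x)
    rw [divergence_smul_const h.differentiableAt, h.fderiv]
    simp
  have hle := abs_integral_mul_divergence_le hu'
    (smul_const_mem_testFields (comp_sub_left_mem_testFunctions hψ x) he.le)
  simp only [hdiv, mul_neg, integral_neg, abs_neg] at hle
  rwa [convolution_precompR_apply _ hu.locallyIntegrable (hψ.2.1.fderiv ℝ)
    (hψ.1.continuous_fderiv one_ne_zero), convolution_def]

theorem lintegral_enorm_translate_sub_le (hu : Integrable u) (h : E d) :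
    ∫⁻ x, ‖u (x + h) - u x‖ₑ ≤ ‖h‖ₑ * variation u := by
  rcases eq_or_ne h 0 with rfl | hh
  · simp
  rcases eq_or_ne (variation u) ∞ with hu' | hu'
  · simp [hu', ENNReal.mul_top, hh]
  have huh : Integrable fun x => u (x + h) := hu.comp_add_right h
  have hw : Integrable fun x => u (x + h) - u x := huh.sub hu
  rw [← ofReal_integral_norm_eq_lintegral_enorm hw, ← ENNReal.ofReal_toReal hu',
    ← ofReal_norm, ← ENNReal.ofReal_mul (norm_nonneg h)]
  refine ENNReal.ofReal_le_ofReal (integral_abs_le_of_forall_testFunctions hw fun ψ hψ => ?_)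
  have hψ' := comp_sub_left_mem_testFunctions hψ 0
  have hshift : ∫ x, u (x + h) * ψ x = ∫ x, u x * ψ (x - h) := by
    rw [← integral_add_right_eq_self (fun x => u x * ψ (x - h)) h]
    simp
  have hlip := (lipschitzWith_convolution hu hu' hψ').dist_le_mul h 0
  simp only [convolution_def, ContinuousLinearMap.lsmul_apply, smul_eq_mul, zero_sub, neg_sub,
    neg_neg, dist_zero_right] at hlip
  simp only [sub_mul]
  rw [integral_sub (integrable_mul_testFunction huh hψ) (integrable_mul_testFunction hu hψ), hshift,
    mul_comm]
  exact (le_abs_self _).trans hlip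

end Translation

/-! ### The Poincaré inequality -/

theorem setLIntegral_enorm_sub_setAverage_le {α F : Type*} [MeasurableSpace α]
    [NormedAddCommGroup F] [NormedSpace ℝ F] [CompleteSpace F] {μ : Measure α} {u : α → F}
    {Q : Set α} (hu : IntegrableOn u Q μ) (h0 : μ Q ≠ 0) (htop : μ Q ≠ ∞) :
    ∫⁻ x in Q, ‖u x - ⨍ y in Q, u y ∂μ‖ₑ ∂μ ≤
      (μ Q)⁻¹ * ∫⁻ x in Q, ∫⁻ y in Q, ‖u x - u y‖ₑ ∂μ ∂μ := by
  rw [← lintegral_const_mul' _ _ (ENNReal.inv_ne_top.2 h0)]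
  refine lintegral_mono fun x => ?_
  have hsub : u x - ⨍ y in Q, u y ∂μ = ⨍ y in Q, (u x - u y) ∂μ := by
    conv_lhs => rw [← setAverage_const h0 htop (u x)]
    simp only [setAverage_eq]
    rw [← smul_sub, integral_sub (integrableOn_const htop).integrable hu]
  calc ‖u x - ⨍ y in Q, u y ∂μ‖ₑ ≤ ⨍⁻ y in Q, ‖u x - u y‖ₑ ∂μ := by
        rw [hsub]
        exact enorm_integral_le_lintegral_enorm _
    _ = (μ Q)⁻¹ * ∫⁻ y in Q, ‖u x - u y‖ₑ ∂μ := by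
        rw [setLAverage_eq, ENNReal.div_eq_inv_mul]

section Poincare

variable {d : ℕ} {u : E d → ℝ}

theorem lintegral_setLIntegral_translate_sub_le (hu : Integrable u) {ρ : ℝ} :
    ∫⁻ x, ∫⁻ h in Metric.closedBall 0 ρ, ‖u (x + h) - u x‖ₑ ≤
      volume (Metric.closedBall (0 : E d) ρ) * ENNReal.ofReal ρ * variation u := by
  have hm : AEMeasurable (fun p : E d × E d => ‖u (p.1 + p.2) - u p.1‖ₑ)
      (volume.prod (volume.restrict (Metric.closedBall 0 ρ))) := by
    have hadd : AEStronglyMeasurable (fun p : E d × E d => u (p.1 + p.2)) (volume.prod volume) :=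
      hu.aestronglyMeasurable.comp_quasiMeasurePreserving
        (Measure.quasiMeasurePreserving_snd.comp
          (measurePreserving_prod_add volume volume).quasiMeasurePreserving)
    exact (hadd.sub hu.aestronglyMeasurable.comp_fst).enorm.mono_ac
      (Measure.AbsolutelyContinuous.rfl.prod Measure.absolutelyContinuous_restrict)
  calc ∫⁻ x, ∫⁻ h in Metric.closedBall 0 ρ, ‖u (x + h) - u x‖ₑ
      = ∫⁻ h in Metric.closedBall 0 ρ, ∫⁻ x, ‖u (x + h) - u x‖ₑ := lintegral_lintegral_swap hm
    _ ≤ ∫⁻ _ in Metric.closedBall (0 : E d) ρ, ENNReal.ofReal ρ * variation u := by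
        refine setLIntegral_mono measurable_const fun h hh => ?_
        refine (lintegral_enorm_translate_sub_le hu h).trans (mul_le_mul_left ?_ _)
        rw [← ofReal_norm]
        exact ENNReal.ofReal_le_ofReal (mem_closedBall_zero_iff.1 hh)
    _ = volume (Metric.closedBall (0 : E d) ρ) * ENNReal.ofReal ρ * variation u := by
        rw [setLIntegral_const]
        ring

theorem setLIntegral_le_setLIntegral_closedBall_add {Q : Set (E d)} {ρ : ℝ}
    (hρ : ∀ x ∈ Q, ∀ y ∈ Q, dist x y ≤ ρ) (f : E d → ℝ≥0∞) {x : E d} (hx : x ∈ Q) :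
    ∫⁻ y in Q, f y ≤ ∫⁻ h in Metric.closedBall 0 ρ, f (x + h) := by
  rw [← (measurePreserving_add_left volume x).setLIntegral_comp_preimage_emb
    (measurableEmbedding_addLeft x) f Q]
  refine lintegral_mono_set fun h hh => ?_
  simpa [dist_eq_norm] using hρ (x + h) hh x hx

theorem sum_setLIntegral_enorm_sub_setAverage_le (hu : Integrable u) {ι : Type*} [Fintype ι]
    {Q : ι → Set (E d)} (hQ : ∀ i, MeasurableSet (Q i))
    (hdisj : Pairwise fun i j => AEDisjoint volume (Q i) (Q j)) {ρ : ℝ}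
    (hρ : ∀ i, ∀ x ∈ Q i, ∀ y ∈ Q i, dist x y ≤ ρ) {V : ℝ≥0∞} (hV : V ≠ 0)
    (hQV : ∀ i, V ≤ volume (Q i)) :
    ∑ i, ∫⁻ x in Q i, ‖u x - ⨍ y in Q i, u y‖ₑ ≤
      V⁻¹ * (volume (Metric.closedBall (0 : E d) ρ) * ENNReal.ofReal ρ * variation u) := by
  have hone : ∀ i, ∫⁻ x in Q i, ‖u x - ⨍ y in Q i, u y‖ₑ ≤
      V⁻¹ * ∫⁻ x in Q i, ∫⁻ h in Metric.closedBall 0 ρ, ‖u (x + h) - u x‖ₑ := by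
    intro i
    have htop : volume (Q i) ≠ ∞ :=
      (Metric.isBounded_iff.2 ⟨ρ, fun x hx y hy => hρ i x hx y hy⟩).measure_lt_top.ne
    refine (setLIntegral_enorm_sub_setAverage_le hu.integrableOn
      (hV.bot_lt.trans_le (hQV i)).ne' htop).trans ?_
    refine mul_le_mul' (ENNReal.inv_le_inv.2 (hQV i)) (setLIntegral_mono' (hQ i) fun x hx => ?_)
    simp only [enorm_sub_rev (u x)]
    exact setLIntegral_le_setLIntegral_closedBall_add (hρ i) (fun y => ‖u y - u x‖ₑ) hx
  calc ∑ i, ∫⁻ x in Q i, ‖u x - ⨍ y in Q i, u y‖ₑ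
      ≤ V⁻¹ * ∑ i, ∫⁻ x in Q i, ∫⁻ h in Metric.closedBall 0 ρ, ‖u (x + h) - u x‖ₑ := by
        rw [Finset.mul_sum]
        exact Finset.sum_le_sum fun i _ => hone i
    _ = V⁻¹ * ∫⁻ x in ⋃ i, Q i, ∫⁻ h in Metric.closedBall 0 ρ, ‖u (x + h) - u x‖ₑ := by
        rw [lintegral_iUnion₀ (fun i => (hQ i).nullMeasurableSet) hdisj, tsum_fintype]
    _ ≤ V⁻¹ * (volume (Metric.closedBall (0 : E d) ρ) * ENNReal.ofReal ρ * variation u) :=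
        mul_le_mul_right ((setLIntegral_le_lintegral _ _).trans
          (lintegral_setLIntegral_translate_sub_le hu)) _

end Poincare

/-! ### Boxes and dyadic cubes -/

/-- The box `∏ᵢ [aᵢ, bᵢ]` in `ℝᵈ`; the dyadic cubes are boxes by definition. -/
def box {d : ℕ} (a b : Fin d → ℝ) : Set (E d) := {x | ∀ i, x i ∈ Icc (a i) (b i)}

section Box

variable {d : ℕ} {a b : Fin d → ℝ}

theorem box_eq_preimage (a b : Fin d → ℝ) :
    box a b = (WithLp.ofLp : E d → Fin d → ℝ) ⁻¹' Icc a b := by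
  ext x
  simp only [box, mem_ofPred_eq, mem_preimage, mem_Icc, Pi.le_def, forall_and]

theorem measurableSet_box (a b : Fin d → ℝ) : MeasurableSet (box a b) := by
  rw [box_eq_preimage]
  exact measurableSet_Icc.preimage (PiLp.volume_preserving_ofLp (Fin d)).measurable

theorem box_inter_box (a b a' b' : Fin d → ℝ) :
    box a b ∩ box a' b' = box (a ⊔ a') (b ⊓ b') := by
  simp only [box_eq_preimage, ← preimage_inter, Icc_inter_Icc]

theorem volume_box (a b : Fin d → ℝ) :
    volume (box a b) = ∏ i, ENNReal.ofReal (b i - a i) := by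
  rw [box_eq_preimage, (PiLp.volume_preserving_ofLp (Fin d)).measure_preimage
    measurableSet_Icc.nullMeasurableSet, Real.volume_Icc_pi]

theorem setIntegral_box (a b : Fin d → ℝ) (f : E d → ℝ) :
    ∫ x in box a b, f x = ∫ y in Icc a b, f (WithLp.toLp 2 y) := by
  rw [box_eq_preimage]
  exact ((PiLp.volume_preserving_toLp (Fin d)).setIntegral_preimage_emb
    (MeasurableEquiv.toLp 2 (Fin d → ℝ)).measurableEmbedding f _).symm

theorem abs_setIntegral_Icc_le_prod (hab : a ≤ b) {f : (Fin d → ℝ) → ℝ} (hf : ∀ y, |f y| ≤ 1) :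
    |∫ y in Icc a b, f y| ≤ ∏ i, (b i - a i) := by
  have h := norm_setIntegral_le_of_norm_le_const (μ := volume) (s := Icc a b) (C := 1) (f := f)
    isCompact_Icc.measure_lt_top fun y _ => hf y
  rwa [measureReal_def, Real.volume_Icc_pi_toReal hab, one_mul] at h

theorem setIntegral_divergence_box {n : ℕ} {a b : Fin (n + 1) → ℝ} (hab : a ≤ b)
    {v : E (n + 1) → E (n + 1)} (hv : ContDiff ℝ 1 v) :
    ∫ x in box a b, divergence v x = ∑ i : Fin (n + 1),
      ((∫ y in Icc (a ∘ i.succAbove) (b ∘ i.succAbove),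
          v (WithLp.toLp 2 (i.insertNth (b i) y)) i) -
        ∫ y in Icc (a ∘ i.succAbove) (b ∘ i.succAbove),
          v (WithLp.toLp 2 (i.insertNth (a i) y)) i) := by
  let L : (Fin (n + 1) → ℝ) →L[ℝ] E (n + 1) :=
    (PiLp.continuousLinearEquiv 2 ℝ (fun _ : Fin (n + 1) => ℝ)).symm
  have hcont : Continuous v := hv.continuous
  have hderiv : ∀ (i : Fin (n + 1)) (y : Fin (n + 1) → ℝ), HasFDerivAt (fun y => v (L y) i)
      ((EuclideanSpace.proj i).comp ((fderiv ℝ v (L y)).comp L)) y := fun i y =>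
    (EuclideanSpace.proj i : E (n + 1) →L[ℝ] ℝ).hasFDerivAt.comp y
      ((hv.differentiable one_ne_zero _).hasFDerivAt.comp y L.hasFDerivAt)
  rw [setIntegral_box]
  refine integral_divergence_of_hasFDerivAt_off_countable' a b hab (fun i y => v (L y) i) _ ∅
    countable_empty (fun i => by fun_prop) (fun y _ i => hderiv i y) ?_
  have hdiv : Continuous (divergence v) := by
    have := hv.continuous_fderiv one_ne_zero
    unfold divergence
    fun_prop
  exact (hdiv.comp L.continuous).continuousOn.integrableOn_compact isCompact_Icc

theorem integral_indicator_one_mul {α : Type*} [MeasurableSpace α] {μ : Measure α} {s : Set α}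
    (hs : MeasurableSet s) (f : α → ℝ) :
    ∫ x, s.indicator (fun _ => (1 : ℝ)) x * f x ∂μ = ∫ x in s, f x ∂μ := by
  simp only [← indicator_mul_left, one_mul, integral_indicator hs]

theorem variation_indicator_box_le (hab : a ≤ b) :
    variation ((box a b).indicator fun _ => (1 : ℝ)) ≤
      ENNReal.ofReal (∑ i, 2 * ∏ j ∈ {i}ᶜ, (b j - a j)) := by
  refine iSup₂_le fun v hv => ENNReal.ofReal_le_ofReal ?_
  rw [integral_indicator_one_mul (measurableSet_box a b)]
  cases d with
  | zero => simp [divergence]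
  | succ n =>
    rw [setIntegral_divergence_box hab hv.1]
    refine Finset.sum_le_sum fun i _ => ?_
    have hface : ∏ j ∈ {i}ᶜ, (b j - a j) = ∏ j, (b (i.succAbove j) - a (i.succAbove j)) := by
      rw [← Fin.image_succAbove_univ, Finset.prod_image i.succAbove_right_injective.injOn]
    have hle : ∀ t : ℝ, |∫ y in Icc (a ∘ i.succAbove) (b ∘ i.succAbove),
        v (WithLp.toLp 2 (i.insertNth t y)) i| ≤ ∏ j ∈ {i}ᶜ, (b j - a j) := fun t =>
      hface ▸ abs_setIntegral_Icc_le_prod (fun j => hab _) fun y =>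
        (PiLp.norm_apply_le (v _) i).trans (hv.2.2 _)
    linarith [(abs_le.1 (hle (a i))).1, (abs_le.1 (hle (b i))).2]

end Box

section DyadicCubes

variable {d n : ℕ} {Q Q' : Set (E d)}

theorem add_one_div_sub_div_two_pow (m : ℝ) (n : ℕ) : (m + 1) / 2 ^ n - m / 2 ^ n = (2 ^ n)⁻¹ := by
  ring

theorem volume_dyadicCube (hQ : Q ∈ dyadicCubes d n) :
    volume Q = ENNReal.ofReal (((2 : ℝ) ^ n)⁻¹ ^ d) := by
  obtain ⟨m, -, rfl⟩ := hQ
  refine (volume_box _ _).trans ?_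
  simp only [add_one_div_sub_div_two_pow, Finset.prod_const, Finset.card_univ, Fintype.card_fin]
  rw [ENNReal.ofReal_pow (by positivity)]

theorem volume_dyadicCube_ne_top (hQ : Q ∈ dyadicCubes d n) : volume Q ≠ ∞ := by
  rw [volume_dyadicCube hQ]
  exact ENNReal.ofReal_ne_top

theorem measureReal_dyadicCube (hQ : Q ∈ dyadicCubes d n) :
    volume.real Q = ((2 : ℝ) ^ n)⁻¹ ^ d := by
  rw [measureReal_def, volume_dyadicCube hQ, ENNReal.toReal_ofReal (by positivity)]

theorem dyadicCube_subset_unitCube (hQ : Q ∈ dyadicCubes d n) : Q ⊆ unitCube d := by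
  obtain ⟨m, hm, rfl⟩ := hQ
  intro x hx i
  have hmi : (m i : ℝ) + 1 ≤ 2 ^ n := by exact_mod_cast hm i
  exact ⟨le_trans (by positivity) (hx i).1, (hx i).2.trans ((div_le_one (by positivity)).2 hmi)⟩

theorem aedisjoint_dyadicCubes (hQ : Q ∈ dyadicCubes d n) (hQ' : Q' ∈ dyadicCubes d n)
    (hne : Q ≠ Q') : AEDisjoint volume Q Q' := by
  obtain ⟨m, -, rfl⟩ := hQ
  obtain ⟨m', -, rfl⟩ := hQ'
  obtain ⟨i, hi⟩ : ∃ i, m i ≠ m' i := Function.ne_iff.1 (by rintro rfl; exact hne rfl)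
  change volume (box _ _ ∩ box _ _) = 0
  rw [box_inter_box, volume_box]
  refine Finset.prod_eq_zero (Finset.mem_univ i) (ENNReal.ofReal_of_nonpos ?_)
  simp only [Pi.sup_apply, Pi.inf_apply, sub_nonpos]
  rcases lt_or_gt_of_ne hi with h | h
  · have : (m i : ℝ) + 1 ≤ m' i := by exact_mod_cast h
    exact (inf_le_left.trans (by gcongr)).trans le_sup_right
  · have : (m' i : ℝ) + 1 ≤ m i := by exact_mod_cast h
    exact (inf_le_right.trans (by gcongr)).trans le_sup_left

theorem dist_le_of_mem_dyadicCube (hQ : Q ∈ dyadicCubes d n) {x y : E d} (hx : x ∈ Q) (hy : y ∈ Q) :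
    dist x y ≤ √d * ((2 : ℝ) ^ n)⁻¹ := by
  obtain ⟨m, -, rfl⟩ := hQ
  have hcoord : ∀ i, dist (x i) (y i) ≤ ((2 : ℝ) ^ n)⁻¹ := fun i =>
    (Real.dist_le_of_mem_Icc (hx i) (hy i)).trans_eq (add_one_div_sub_div_two_pow _ n)
  rw [EuclideanSpace.dist_eq, Real.sqrt_le_left (by positivity), mul_pow,
    Real.sq_sqrt (Nat.cast_nonneg d)]
  calc ∑ i, dist (x i) (y i) ^ 2 ≤ ∑ _i : Fin d, ((2 : ℝ) ^ n)⁻¹ ^ 2 := by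
        gcongr with i
        exact hcoord i
    _ = d * ((2 : ℝ) ^ n)⁻¹ ^ 2 := by simp

theorem variation_indicator_dyadicCube_le (hQ : Q ∈ dyadicCubes d n) :
    variation (Q.indicator fun _ => (1 : ℝ)) ≤
      ENNReal.ofReal (2 * d * 2 ^ n * ((2 : ℝ) ^ n)⁻¹ ^ d) := by
  obtain ⟨m, -, rfl⟩ := hQ
  refine (variation_indicator_box_le fun i => ?_).trans (ENNReal.ofReal_le_ofReal (le_of_eq ?_))
  · exact div_le_div_of_nonneg_right (by linarith) (by positivity)
  have hface : ∀ i : Fin d, ∏ _j ∈ ({i}ᶜ : Finset (Fin d)), ((2 : ℝ) ^ n)⁻¹ =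
      2 ^ n * ((2 : ℝ) ^ n)⁻¹ ^ d := fun i => by
    have h := Fintype.prod_eq_mul_prod_compl i fun _ : Fin d => ((2 : ℝ) ^ n)⁻¹
    rw [Fin.prod_const] at h
    rw [h, mul_inv_cancel_left₀ (by positivity)]
  simp only [add_one_div_sub_div_two_pow, hface, Finset.sum_const, Finset.card_univ,
    Fintype.card_fin, nsmul_eq_mul]
  ring

end DyadicCubes

/-! ### The Poincaré inequality on dyadic cubes -/

section DyadicPoincare

variable {d n : ℕ} {u : E d → ℝ}

/-- A constant for the `L¹` Poincaré inequality, summed over the dyadic cubes of one generation.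
The cubes of side `s` have diameter `√d s`, and the constant times `s` is the volume of a ball of
radius `√d s`, times `√d s`, divided by the volume `sᵈ` of a cube. -/
def poincareConst (d : ℕ) : ℝ := √d ^ (d + 1) * volume.real (Metric.ball (0 : E d) 1)

theorem poincareConst_nonneg (d : ℕ) : 0 ≤ poincareConst d := by
  unfold poincareConst
  positivity

theorem inv_mul_volume_closedBall_mul (d : ℕ) {s : ℝ} (hs : 0 < s) :
    (ENNReal.ofReal (s ^ d))⁻¹ *
      (volume (Metric.closedBall (0 : E d) (√d * s)) * ENNReal.ofReal (√d * s)) =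
    ENNReal.ofReal (poincareConst d * s) := by
  rw [Measure.addHaar_closedBall _ _ (by positivity), finrank_euclideanSpace_fin,
    ← ENNReal.ofReal_inv_of_pos (by positivity),
    ← ENNReal.ofReal_toReal (measure_ball_lt_top (μ := volume) (x := (0 : E d)) (r := 1)).ne,
    ← ENNReal.ofReal_mul (by positivity), ← ENNReal.ofReal_mul (by positivity),
    ← ENNReal.ofReal_mul (by positivity), poincareConst, measureReal_def]
  congr 1
  field_simp
  ring

theorem sum_setIntegral_abs_sub_setAverage_dyadicCube_le (hu : Integrable u)
    (hu' : variation u ≠ ∞) {ι : Type*} [Fintype ι] {Q : ι → dyadicCubes d n}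
    (hQ : Function.Injective Q) :
    ∑ i, ∫ x in (Q i : Set (E d)), |u x - ⨍ y in (Q i : Set (E d)), u y| ≤
      poincareConst d * ((2 : ℝ) ^ n)⁻¹ * (variation u).toReal := by
  have hs : (0 : ℝ) < (2 ^ n)⁻¹ := by positivity
  have hvol : ∀ i, volume (Q i : Set (E d)) = ENNReal.ofReal (((2 : ℝ) ^ n)⁻¹ ^ d) :=
    fun i => volume_dyadicCube (Q i).2
  have hpoincare := sum_setLIntegral_enorm_sub_setAverage_le hu
    (fun i => measurableSet_dyadicCube (Q i))
    (fun i j hij => aedisjoint_dyadicCubes (Q i).2 (Q j).2 (Subtype.coe_injective.ne (hQ.ne hij)))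
    (fun i x hx y hy => dist_le_of_mem_dyadicCube (Q i).2 hx hy)
    (ENNReal.ofReal_pos.2 (pow_pos hs d)).ne' (fun i => (hvol i).ge)
  rw [← mul_assoc, inv_mul_volume_closedBall_mul d hs, ← ENNReal.ofReal_toReal hu',
    ← ENNReal.ofReal_mul (mul_nonneg (poincareConst_nonneg d) hs.le)] at hpoincare
  have hint : ∀ i, IntegrableOn (fun x => u x - ⨍ y in (Q i : Set (E d)), u y) (Q i) :=
    fun i => hu.integrableOn.sub (integrableOn_const (volume_dyadicCube_ne_top (Q i).2))
  have h_toReal : ∀ i, ∫⁻ x in (Q i : Set (E d)), ‖u x - ⨍ y in (Q i : Set (E d)), u y‖ₑ =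
      ENNReal.ofReal (∫ x in (Q i : Set (E d)), |u x - ⨍ y in (Q i : Set (E d)), u y|) :=
    fun i => (ofReal_integral_norm_eq_lintegral_enorm (hint i)).symm
  simp only [h_toReal] at hpoincare
  rw [← ENNReal.ofReal_sum_of_nonneg fun i _ => integral_nonneg fun x => abs_nonneg _] at hpoincare
  exact (ENNReal.ofReal_le_ofReal_iff
    (mul_nonneg (mul_nonneg (poincareConst_nonneg d) hs.le) ENNReal.toReal_nonneg)).1 hpoincare

end DyadicPoincare

/-! ### The sign matrices -/

section HaarMatrix

/-- The splitting of the indices of `haarMatrix (d + 1)` into those of its four blocks. -/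
def halves (d : ℕ) : Fin (2 ^ (d + 1)) ≃ Fin (2 ^ d) ⊕ Fin (2 ^ d) :=
  (finCongr (by ring)).trans finSumFinEquiv.symm

theorem halves_zero (d : ℕ) : halves d 0 = Sum.inl 0 := by
  rw [← Equiv.eq_symm_apply]
  ext
  simp [halves]

theorem haarMatrix_succ (d : ℕ) : haarMatrix (d + 1) =
    (Matrix.fromBlocks (haarMatrix d) (haarMatrix d) (haarMatrix d)
      (-haarMatrix d)).submatrix (halves d) (halves d) := rfl

theorem haarMatrix_zero_left (d : ℕ) (l : Fin (2 ^ d)) : haarMatrix d 0 l = 1 := by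
  induction d with
  | zero => rfl
  | succ d ih =>
    rw [haarMatrix_succ, Matrix.submatrix_apply, halves_zero]
    rcases halves d l with l | l <;> simp [ih]

theorem abs_haarMatrix (d : ℕ) (r l : Fin (2 ^ d)) : |haarMatrix d r l| = 1 := by
  induction d with
  | zero => exact abs_one
  | succ d ih =>
    rw [haarMatrix_succ, Matrix.submatrix_apply]
    rcases halves d l with l | l <;> rcases halves d r with r | r <;> simp [ih]

theorem haarMatrix_mul_transpose (d : ℕ) :
    haarMatrix d * (haarMatrix d).transpose = (2 : ℝ) ^ d • (1 : Matrix _ _ ℝ) := by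
  induction d with
  | zero =>
    ext i j
    have : Subsingleton (Fin (2 ^ 0)) := inferInstanceAs (Subsingleton (Fin 1))
    rw [Matrix.mul_apply, Subsingleton.elim i j]
    simp only [Matrix.transpose_apply]
    simp [haarMatrix]
  | succ d ih =>
    rw [haarMatrix_succ, Matrix.transpose_submatrix, Matrix.submatrix_mul_equiv,
      Matrix.fromBlocks_transpose, Matrix.fromBlocks_multiply, Matrix.transpose_neg,
      Matrix.neg_mul, Matrix.mul_neg, Matrix.mul_neg, Matrix.neg_mul, neg_neg, ih,
      add_neg_cancel, ← two_smul ℝ, smul_smul, ← pow_succ',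
      ← Matrix.submatrix_one_equiv (halves d), ← Matrix.fromBlocks_one]
    ext i j
    simp only [Matrix.submatrix_apply, Matrix.smul_apply]
    rcases halves d i with i | i <;> rcases halves d j with j | j <;> simp

theorem sum_haarMatrix_mul_haarMatrix {d : ℕ} (r r' : Fin (2 ^ d)) :
    ∑ l, haarMatrix d r l * haarMatrix d r' l = if r = r' then (2 : ℝ) ^ d else 0 := by
  have h := congrFun (congrFun (haarMatrix_mul_transpose d) r) r'
  simpa [Matrix.mul_apply, Matrix.one_apply] using h

theorem sum_haarMatrix_eq_zero {d : ℕ} (r : TypeNumber d) : ∑ l, haarMatrix d r l = 0 := by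
  simpa [haarMatrix_zero_left, r.2] using sum_haarMatrix_mul_haarMatrix (r : Fin (2 ^ d)) 0

end HaarMatrix

/-! ### The Haar charges -/

section HaarCharge

/-- The normalising factor `2^{nd/2}` of the Haar functions of generation `n`. -/
def haarScale (d n : ℕ) : ℝ := 2 ^ ((n : ℝ) * d / 2)

theorem haarScale_pos (d n : ℕ) : 0 < haarScale d n := Real.rpow_pos_of_pos two_pos _

theorem haarScale_mul_self (d n : ℕ) : haarScale d n * haarScale d n = (2 ^ n) ^ d := by
  rw [haarScale, ← Real.rpow_add two_pos, ← pow_mul, ← Real.rpow_natCast]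
  congr 1
  push_cast
  ring

theorem two_rpow_mul_half_add_one (d n : ℕ) :
    (2 : ℝ) ^ ((n : ℝ) * ((d : ℝ) / 2 + 1)) = haarScale d n * 2 ^ n := by
  rw [haarScale, ← Real.rpow_natCast 2 n, ← Real.rpow_add two_pos]
  congr 1
  ring

theorem two_rpow_mul_half_sub_one (d n : ℕ) :
    (2 : ℝ) ^ ((n : ℝ) * ((d : ℝ) / 2 - 1)) = haarScale d n * (2 ^ n)⁻¹ := by
  rw [haarScale, ← Real.rpow_natCast 2 n, ← Real.rpow_neg two_pos.le, ← Real.rpow_add two_pos]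
  congr 1
  ring

theorem childIndex_injective2 {d n : ℕ} : Function.Injective2 (childIndex (d := d) (n := n)) := by
  intro k k' l l' h
  have hval : 2 ^ d * (k : ℕ) + l = 2 ^ d * k' + l' := congrArg Fin.val h
  have hpos : 0 < 2 ^ d := by positivity
  have hdiv := congrArg (· / 2 ^ d) hval
  have hmod := congrArg (· % 2 ^ d) hval
  simp only [Nat.mul_add_div hpos, Nat.div_eq_of_lt l.2, Nat.div_eq_of_lt l'.2, add_zero] at hdiv
  simp only [Nat.mul_add_mod, Nat.mod_eq_of_lt l.2, Nat.mod_eq_of_lt l'.2] at hmod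
  exact ⟨Fin.ext hdiv, Fin.ext hmod⟩

/-- The subcube `K_{n+1,2ᵈk+ℓ}` of `K_{n,k}`. -/
def DyadicNumbering.child {d n : ℕ} (K : DyadicNumbering d) (k : Fin (2 ^ (n * d)))
    (l : Fin (2 ^ d)) : dyadicCubes d (n + 1) := K.cube (n + 1) (childIndex k l)

variable {d n : ℕ} (K : DyadicNumbering d)

theorem DyadicNumbering.child_injective2 : Function.Injective2 (K.child (n := n)) :=
  fun _ _ _ _ h => childIndex_injective2 ((K.cube (n + 1)).injective h)

theorem DyadicNumbering.child_subset_cube (k : Fin (2 ^ (n * d))) (l : Fin (2 ^ d)) :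
    (K.child k l : Set (E d)) ⊆ K.cube n k :=
  ((K.children n k).subset (mem_range_self l)).2

theorem sum_setIntegral_le_setIntegral {α ι : Type*} [MeasurableSpace α] {μ : Measure α}
    [Fintype ι] {s : ι → Set α} {t : Set α} {f : α → ℝ} (hs : ∀ i, MeasurableSet (s i))
    (hd : Pairwise (Function.onFun (AEDisjoint μ) s)) (hst : ∀ i, s i ⊆ t)
    (hf : IntegrableOn f t μ) (hf0 : 0 ≤ f) :
    ∑ i, ∫ x in s i, f x ∂μ ≤ ∫ x in t, f x ∂μ := by
  have hst' : ⋃ i, s i ⊆ t := iUnion_subset hst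
  rw [← tsum_fintype (L := .unconditional ι),
    ← integral_iUnion_ae (fun i => (hs i).nullMeasurableSet) hd (hf.mono_set hst')]
  exact setIntegral_mono_set hf (Eventually.of_forall hf0) hst'.eventuallyLE

theorem haarCharge_apply (k : Fin (2 ^ (n * d))) (r : TypeNumber d) (u : BV d) :
    (haarCharge K n k r : StrongDual ℝ (BV d)) u =
      haarScale d n * ∑ l, haarMatrix d r l * ∫ x in (K.child k l : Set (E d)), u.toL1 x := by
  have hmeas : ∀ l, MeasurableSet (K.child k l : Set (E d)) := fun l => measurableSet_dyadicCube _
  have hu : ∀ l, IntegrableOn (fun x => haarMatrix d r l *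
      (K.child k l : Set (E d)).indicator u.toL1 x) (unitCube d) :=
    fun l => (((integrable_L1 u.toL1).indicator (hmeas l)).const_mul _).integrableOn
  have hpointwise : ∀ x, haar K n k r x * u.toL1 x = haarScale d n *
      ∑ l, haarMatrix d r l * (K.child k l : Set (E d)).indicator u.toL1 x := fun x => by
    simp only [haar, haarScale, DyadicNumbering.child, mul_assoc, Finset.sum_mul,
      ← indicator_mul_left, one_mul]
  calc (haarCharge K n k r : StrongDual ℝ (BV d)) u
      = ∫ x in unitCube d, haar K n k r x * u.toL1 x := rfl
    _ = haarScale d n * ∑ l, haarMatrix d r l *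
          ∫ x in unitCube d, (K.child k l : Set (E d)).indicator u.toL1 x := by
        simp only [hpointwise]
        rw [integral_const_mul, integral_finsetSum _ fun l _ => hu l]
        simp only [integral_const_mul]
    _ = _ := by
        simp only [setIntegral_indicator (hmeas _),
          inter_eq_right.2 (dyadicCube_subset_unitCube (K.child k _).2)]

/-- Since `g_{n,k,r}` has mean zero, the charge does not change when `u` is replaced by `u - c`
on `K_{n,k}`. -/
theorem abs_haarCharge_apply_le (k : Fin (2 ^ (n * d))) (r : TypeNumber d) (u : BV d) (c : ℝ) :
    |(haarCharge K n k r : StrongDual ℝ (BV d)) u| ≤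
      haarScale d n * ∫ x in (K.cube n k : Set (E d)), |u.toL1 x - c| := by
  have hint : ∀ {m} (Q : dyadicCubes d m), IntegrableOn (fun x => u.toL1 x - c) Q := fun Q =>
    (integrable_L1 u.toL1).integrableOn.sub (integrableOn_const (volume_dyadicCube_ne_top Q.2))
  have hsub : ∀ l, ∫ x in (K.child k l : Set (E d)), u.toL1 x =
      (∫ x in (K.child k l : Set (E d)), (u.toL1 x - c)) + ((2 : ℝ) ^ (n + 1))⁻¹ ^ d * c := by
    intro l
    rw [integral_sub (integrable_L1 u.toL1).integrableOn
      (integrableOn_const (volume_dyadicCube_ne_top (K.child k l).2)), setIntegral_const,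
      measureReal_dyadicCube (K.child k l).2, smul_eq_mul, sub_add_cancel]
  have hchild : ∑ l, ∫ x in (K.child k l : Set (E d)), |u.toL1 x - c| ≤
      ∫ x in (K.cube n k : Set (E d)), |u.toL1 x - c| :=
    sum_setIntegral_le_setIntegral (fun l => measurableSet_dyadicCube _)
      (fun l l' hl => aedisjoint_dyadicCubes (K.child k l).2 (K.child k l').2
        (Subtype.coe_injective.ne ((K.child_injective2.right k).ne hl)))
      (K.child_subset_cube k) (hint _).abs fun x => abs_nonneg _
  rw [haarCharge_apply, abs_mul, abs_of_pos (haarScale_pos d n)]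
  refine mul_le_mul_of_nonneg_left ?_ (haarScale_pos d n).le
  calc |∑ l, haarMatrix d r l * ∫ x in (K.child k l : Set (E d)), u.toL1 x|
      = |∑ l, haarMatrix d r l * ∫ x in (K.child k l : Set (E d)), (u.toL1 x - c)| := by
        simp only [hsub, mul_add, Finset.sum_add_distrib, ← Finset.sum_mul,
          sum_haarMatrix_eq_zero r, zero_mul, add_zero]
    _ ≤ ∑ l, |haarMatrix d r l * ∫ x in (K.child k l : Set (E d)), (u.toL1 x - c)| :=
        Finset.abs_sum_le_sum_abs _ _
    _ ≤ ∑ l, ∫ x in (K.child k l : Set (E d)), |u.toL1 x - c| := by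
        gcongr with l
        rw [abs_mul, abs_haarMatrix, one_mul]
        exact abs_integral_le_integral_abs
    _ ≤ _ := hchild

theorem sum_smul_haarCharge_apply (a : Fin (2 ^ (n * d)) → TypeNumber d → ℝ) (u : BV d) :
    (↑(∑ k, ∑ r, a k r • haarCharge K n k r) : StrongDual ℝ (BV d)) u =
      ∑ k, ∑ r, a k r * (haarCharge K n k r : StrongDual ℝ (BV d)) u := by
  simp only [Submodule.coe_sum, Submodule.coe_smul, sum_apply, smul_apply, smul_eq_mul]

theorem norm_sum_smul_haarCharge_le {a : Fin (2 ^ (n * d)) → TypeNumber d → ℝ} {M : ℝ}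
    (hM : 0 ≤ M) (ha : ∀ k r, |a k r| ≤ M) :
    ‖∑ k, ∑ r, a k r • haarCharge K n k r‖ ≤
      2 ^ d * poincareConst d * (haarScale d n * (2 ^ n)⁻¹) * M := by
  have hP := haarScale_pos d n
  have hpoincare_nonneg := poincareConst_nonneg d
  rw [← Submodule.norm_coe]
  refine ContinuousLinearMap.opNorm_le_bound _ (by positivity) fun u => ?_
  have hcard : (Fintype.card (TypeNumber d) : ℝ) ≤ 2 ^ d := by
    exact_mod_cast (Fintype.card_subtype_le _).trans_eq (Fintype.card_fin _)
  have hvar : (variation u.toL1).toReal ≤ ‖u‖ := by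
    rw [BV.norm_def]
    exact le_add_of_nonneg_left (norm_nonneg _)
  set osc : Fin (2 ^ (n * d)) → ℝ := fun k => ∫ x in (K.cube n k : Set (E d)),
    |u.toL1 x - ⨍ y in (K.cube n k : Set (E d)), u.toL1 y|
  have hosc : ∑ k, osc k ≤ poincareConst d * ((2 : ℝ) ^ n)⁻¹ * (variation u.toL1).toReal :=
    sum_setIntegral_abs_sub_setAverage_dyadicCube_le (integrable_L1 u.toL1)
      u.variation_lt_top.ne (K.cube n).injective
  rw [sum_smul_haarCharge_apply]
  calc ‖∑ k, ∑ r, a k r * (haarCharge K n k r : StrongDual ℝ (BV d)) u‖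
      ≤ ∑ k, ∑ r, ‖a k r * (haarCharge K n k r : StrongDual ℝ (BV d)) u‖ :=
        (norm_sum_le _ _).trans (Finset.sum_le_sum fun k _ => norm_sum_le _ _)
    _ ≤ ∑ k, ∑ _r : TypeNumber d, M * (haarScale d n * osc k) := by
        gcongr with k _ r
        rw [norm_mul]
        exact mul_le_mul (ha k r) (abs_haarCharge_apply_le K k r u _) (norm_nonneg _) hM
    _ = Fintype.card (TypeNumber d) * (M * haarScale d n * ∑ k, osc k) := by
        simp only [Finset.sum_const, Finset.card_univ, nsmul_eq_mul, Finset.mul_sum, mul_assoc]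
    _ ≤ 2 ^ d * (M * haarScale d n * (poincareConst d * (2 ^ n)⁻¹ * ‖u‖)) := by
        gcongr
        exact hosc.trans (by gcongr)
    _ = _ := by ring

end HaarCharge

/-! ### Testing against the Haar functions -/

section HaarBV

/-- The class in `BV([0,1]ᵈ)` of the indicator function of a dyadic cube. -/
def cubeIndicator {d n : ℕ} (Q : dyadicCubes d n) : BV d :=
  ⟨indicatorConstLp 1 (measurableSet_dyadicCube Q) (volume_dyadicCube_ne_top Q.2) (1 : ℝ), by
    have hae := indicatorConstLp_coeFn (p := 1) (hs := measurableSet_dyadicCube Q)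
      (hμs := volume_dyadicCube_ne_top Q.2) (c := (1 : ℝ))
    refine ⟨?_, ?_⟩
    · filter_upwards [hae] with x hx hx'
      rw [hx, indicator_of_notMem fun h => hx' (dyadicCube_subset_unitCube Q.2 h)]
    · rw [variation_congr hae]
      exact (variation_indicator_dyadicCube_le Q.2).trans_lt ENNReal.ofReal_lt_top⟩

variable {d n : ℕ}

theorem toL1_cubeIndicator (Q : dyadicCubes d n) : (cubeIndicator Q).toL1 =
    indicatorConstLp 1 (measurableSet_dyadicCube Q) (volume_dyadicCube_ne_top Q.2) (1 : ℝ) := rfl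

theorem toL1_cubeIndicator_ae_eq (Q : dyadicCubes d n) :
    (cubeIndicator Q).toL1 =ᵐ[volume] (Q : Set (E d)).indicator fun _ => (1 : ℝ) := by
  rw [toL1_cubeIndicator]
  exact indicatorConstLp_coeFn

theorem setIntegral_cubeIndicator (Q Q' : dyadicCubes d n) :
    ∫ x in (Q : Set (E d)), (cubeIndicator Q').toL1 x =
      if Q = Q' then ((2 : ℝ) ^ n)⁻¹ ^ d else 0 := by
  rw [setIntegral_congr_ae (measurableSet_dyadicCube Q)
    ((toL1_cubeIndicator_ae_eq Q').mono fun x hx _ => hx),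
    setIntegral_indicator (measurableSet_dyadicCube Q'), setIntegral_one_eq_measureReal]
  split_ifs with h
  · rw [h, inter_self, measureReal_dyadicCube Q'.2]
  · rw [measureReal_def, aedisjoint_dyadicCubes Q.2 Q'.2 (Subtype.coe_injective.ne h),
      ENNReal.toReal_zero]

theorem norm_cubeIndicator_le (Q : dyadicCubes d n) :
    ‖cubeIndicator Q‖ ≤ (1 + 2 * d) * 2 ^ n * ((2 : ℝ) ^ n)⁻¹ ^ d := by
  have hnorm : ‖(cubeIndicator Q).toL1‖ = ((2 : ℝ) ^ n)⁻¹ ^ d := by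
    rw [toL1_cubeIndicator, norm_indicatorConstLp one_ne_zero ENNReal.one_ne_top,
      measureReal_dyadicCube Q.2]
    simp
  have hvar : (variation (cubeIndicator Q).toL1).toReal ≤
      2 * d * 2 ^ n * ((2 : ℝ) ^ n)⁻¹ ^ d := by
    rw [variation_congr (toL1_cubeIndicator_ae_eq Q)]
    exact ENNReal.toReal_le_of_le_ofReal (by positivity) (variation_indicator_dyadicCube_le Q.2)
  calc ‖cubeIndicator Q‖
      ≤ ((2 : ℝ) ^ n)⁻¹ ^ d + 2 * d * 2 ^ n * ((2 : ℝ) ^ n)⁻¹ ^ d := by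
        rw [BV.norm_def, hnorm]
        gcongr
    _ ≤ 2 ^ n * ((2 : ℝ) ^ n)⁻¹ ^ d + 2 * d * 2 ^ n * ((2 : ℝ) ^ n)⁻¹ ^ d := by
        gcongr
        exact le_mul_of_one_le_left (by positivity) (one_le_pow₀ one_le_two)
    _ = _ := by ring

variable (K : DyadicNumbering d)

/-- The class in `BV([0,1]ᵈ)` of the Haar function `g_{n,k,r}`. -/
def haarBV (n : ℕ) (k : Fin (2 ^ (n * d))) (r : TypeNumber d) : BV d :=
  haarScale d n • ∑ l, haarMatrix d r l • cubeIndicator (K.child k l)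

theorem haarCharge_haarBV (k k' : Fin (2 ^ (n * d))) (r r' : TypeNumber d) :
    (haarCharge K n k r : StrongDual ℝ (BV d)) (haarBV K n k' r') =
      if k = k' ∧ r = r' then 1 else 0 := by
  have hchild : ∀ l', (haarCharge K n k r : StrongDual ℝ (BV d)) (cubeIndicator (K.child k' l')) =
      haarScale d n * if k = k' then haarMatrix d r l' * ((2 : ℝ) ^ (n + 1))⁻¹ ^ d else 0 := by
    intro l'
    simp only [haarCharge_apply, setIntegral_cubeIndicator, K.child_injective2.eq_iff, ite_and,
      mul_ite, mul_zero]
    split_ifs <;> simp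
  have hvol : haarScale d n * haarScale d n * (2 ^ d * ((2 : ℝ) ^ (n + 1))⁻¹ ^ d) = 1 := by
    rw [haarScale_mul_self, ← mul_pow, ← mul_pow, pow_succ]
    field_simp
    simp
  simp only [haarBV, map_smul, map_sum, hchild, smul_eq_mul]
  by_cases hk : k = k'
  · simp only [hk, if_true, true_and]
    calc haarScale d n * ∑ l, haarMatrix d r' l *
          (haarScale d n * (haarMatrix d r l * ((2 : ℝ) ^ (n + 1))⁻¹ ^ d))
        = haarScale d n * haarScale d n * ((∑ l, haarMatrix d r l * haarMatrix d r' l) *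
            ((2 : ℝ) ^ (n + 1))⁻¹ ^ d) := by
          simp only [Finset.mul_sum, Finset.sum_mul]
          exact Finset.sum_congr rfl fun l _ => by ring
      _ = _ := by
          rw [sum_haarMatrix_mul_haarMatrix, ite_mul, zero_mul, mul_ite, mul_zero, hvol]
          simp only [Subtype.ext_iff]
  · simp [hk]

theorem norm_haarBV_le (k : Fin (2 ^ (n * d))) (r : TypeNumber d) :
    ‖haarBV K n k r‖ ≤ 2 * (1 + 2 * d) * (haarScale d n * 2 ^ n) * ((2 : ℝ) ^ n)⁻¹ ^ d := by
  have hP := haarScale_pos d n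
  calc ‖haarBV K n k r‖
      ≤ haarScale d n * ∑ l, ‖haarMatrix d r l • cubeIndicator (K.child k l)‖ := by
        rw [haarBV, norm_smul, Real.norm_of_nonneg hP.le]
        gcongr
        exact norm_sum_le _ _
    _ ≤ haarScale d n * ∑ _l : Fin (2 ^ d),
          (1 + 2 * d) * 2 ^ (n + 1) * ((2 : ℝ) ^ (n + 1))⁻¹ ^ d := by
        gcongr with l
        rw [norm_smul, Real.norm_eq_abs, abs_haarMatrix, one_mul]
        exact norm_cubeIndicator_le _
    _ = 2 * (1 + 2 * d) * (haarScale d n * 2 ^ n) *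
          (2 ^ d * ((2 : ℝ) ^ (n + 1))⁻¹ ^ d) := by
        rw [Finset.sum_const, Finset.card_univ, Fintype.card_fin, nsmul_eq_mul]
        push_cast
        ring
    _ = _ := by
        rw [← mul_pow, pow_succ, mul_inv_rev, mul_inv_cancel_left₀ two_ne_zero]

theorem sum_abs_le_norm_sum_smul_haarCharge (a : Fin (2 ^ (n * d)) → TypeNumber d → ℝ)
    (r : TypeNumber d) :
    ∑ k, |a k r| ≤ ‖∑ k, ∑ r, a k r • haarCharge K n k r‖ *
      (2 * (1 + 2 * d) * (haarScale d n * 2 ^ n)) := by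
  set u : BV d := ∑ k, (SignType.sign (a k r) : ℝ) • haarBV K n k r with hu
  set α : StrongDual ℝ (BV d) := ↑(∑ k, ∑ r, a k r • haarCharge K n k r) with hα
  have hαu : α u = ∑ k, |a k r| := by
    have hdual : ∀ k, α (haarBV K n k r) = a k r := fun k => by
      rw [hα, sum_smul_haarCharge_apply]
      simp [haarCharge_haarBV, ite_and]
    simp only [hu, map_sum, map_smul, hdual, smul_eq_mul, sign_mul_self]
  have hsign : ∀ t : ℝ, ‖(SignType.sign t : ℝ)‖ ≤ 1 := fun t => by
    rcases SignType.sign t <;> simp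
  have hnorm : ‖u‖ ≤ 2 * (1 + 2 * d) * (haarScale d n * 2 ^ n) := by
    calc ‖u‖ ≤ ∑ k, ‖(SignType.sign (a k r) : ℝ) • haarBV K n k r‖ := norm_sum_le _ _
      _ ≤ ∑ _k : Fin (2 ^ (n * d)),
            2 * (1 + 2 * d) * (haarScale d n * 2 ^ n) * ((2 : ℝ) ^ n)⁻¹ ^ d := by
          gcongr with k
          rw [norm_smul]
          exact (mul_le_of_le_one_left (norm_nonneg _) (hsign _)).trans (norm_haarBV_le K k r)
      _ = 2 * (1 + 2 * d) * (haarScale d n * 2 ^ n) * (2 ^ n * ((2 : ℝ) ^ n)⁻¹) ^ d := by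
          rw [Finset.sum_const, Finset.card_univ, Fintype.card_fin, nsmul_eq_mul]
          push_cast
          ring
      _ = _ := by rw [mul_inv_cancel₀ (by positivity), one_pow, mul_one]
  calc ∑ k, |a k r| = α u := hαu.symm
    _ ≤ ‖α‖ * ‖u‖ := (le_abs_self _).trans (α.le_opNorm u)
    _ ≤ _ := mul_le_mul_of_nonneg_left hnorm (norm_nonneg _)

end HaarBV

end StrongCharge

end

theorem mainTheorem11 (d : ℕ) (hd : 1 ≤ d) :
    ∃ C : ℝ, 0 < C ∧
      ∀ (K : StrongCharge.DyadicNumbering d) (n : ℕ)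
        (a : Fin (2 ^ (n * d)) → StrongCharge.TypeNumber d → ℝ),
        1 / ((2 : ℝ) ^ ((n : ℝ) * ((d : ℝ) / 2 + 1)) * C) *
            (⨆ r : StrongCharge.TypeNumber d, ∑ k, |a k r|)
          ≤ ‖∑ k, ∑ r, a k r • StrongCharge.haarCharge K n k r‖ ∧
        ‖∑ k, ∑ r, a k r • StrongCharge.haarCharge K n k r‖
          ≤ C * (2 : ℝ) ^ ((n : ℝ) * ((d : ℝ) / 2 - 1)) *
            (⨆ p : Fin (2 ^ (n * d)) × StrongCharge.TypeNumber d, |a p.1 p.2|) := by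
  have hC := StrongCharge.poincareConst_nonneg d
  refine ⟨2 * (1 + 2 * d) + 2 ^ d * StrongCharge.poincareConst d, by positivity,
    fun K n a => ?_⟩
  have hP := StrongCharge.haarScale_pos d n
  rw [StrongCharge.two_rpow_mul_half_add_one, StrongCharge.two_rpow_mul_half_sub_one]
  constructor
  · rw [one_div_mul_eq_div, div_le_iff₀ (by positivity)]
    refine Real.iSup_le (fun r => ?_) (by positivity)
    calc ∑ k, |a k r|
        ≤ ‖∑ k, ∑ r, a k r • StrongCharge.haarCharge K n k r‖ *
            (2 * (1 + 2 * d) * (StrongCharge.haarScale d n * 2 ^ n)) :=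
          StrongCharge.sum_abs_le_norm_sum_smul_haarCharge K a r
      _ ≤ _ := by
          rw [mul_comm (StrongCharge.haarScale d n * 2 ^ n)]
          gcongr
          exact le_add_of_nonneg_right (by positivity)
  · set M := ⨆ p : Fin (2 ^ (n * d)) × StrongCharge.TypeNumber d, |a p.1 p.2|
    have hM : 0 ≤ M := Real.iSup_nonneg fun p => abs_nonneg _
    have ha : ∀ k r, |a k r| ≤ M := fun k r =>
      le_ciSup (f := fun p : _ × _ => |a p.1 p.2|) (Set.finite_range _).bddAbove (k, r)
    refine (StrongCharge.norm_sum_smul_haarCharge_le K hM ha).trans ?_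
    gcongr
    exact le_add_of_nonneg_left (by positivity)
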